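/- Let $d_1,d_2\in\mathbb N$, $T>0$, $C_H>0$, $\gamma\ge 1$. Let $u_0:\mathbb R^{d_1}\times\mathbb R^{d_2}\to\mathbb R$ be bounded and Lipschitz continuous, and let $H=H(x,y,p,q)\in C^2(\mathbb R^{d_1}\times\mathbb R^{d_2}\times\mathbb R^{d_1}\times\mathbb R^{d_2})$ satisfy, for all $(x,y,p,q)$, \[ H\ge 0,\qquad \partial^2_{pp}H>0,\qquad \partial^2_{qq}H>0,\qquad |\partial_yH|\le C_H(1+|p|^\gamma+|q|^\gamma), \] \[ \langle\partial_pH,p\rangle+\langle\partial_qH,q\rangle-H\ \ge\ C_H^{-1}(|p|^\gamma+|q|^\gamma)-C_H . \] Let $\sigma>0$ and let $u$ be a classical solution of \[ \partial_tu-\sigma\Delta u+H(x,y,\partial_xu,\partial_yu)=0\ \text{ in }(0,T)\times\mathbb R^{d_1}\times\mathbb R^{d_2},\qquad u(0,\cdot,\cdot)=u_0, \] continuous on $[0,T]\times\mathbb R^{d_1}\times\mathbb R^{d_2}$. Assume that $u$ has at most polynomial growth in $(x,y)$, uniformly in $t\in[0,T]$, and that the drift of the Fokker--Planck equation dual to the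 equation is non-explosive: for some $K\in\mathbb R$ (which may depend on $u$ and $\sigma$), \[ -\langle\partial_pH(x,y,\partial_xu,\partial_yu),x\rangle-\langle\partial_qH(x,y,\partial_xu,\partial_yu),y\rangle\le K(1+|x|^2+|y|^2) \] on $(0,T)\times\mathbb R^{d_1}\times\mathbb R^{d_2}$ (for instance, $\partial_pH$ and $\partial_qH$ have at most linear growth in $(x,y)$ along $u$). Then \[ \sup_{t\in[0,T]}\|u(t,\cdot,\cdot)\|_{L^\infty(\mathbb R^{d_1}\times\mathbb R^{d_2})}\ \le\ \|u_0\|_{L^\infty(\mathbb R^{d_1}\times\mathbb R^{d_2})}+C_HT . \] In particular the bound is independent of $\sigma>0$. -/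

import Mathlib

open Set MeasureTheory
open scoped ENNReal

noncomputable section

/-- Euclidean space `ℝ^d`. -/
abbrev Euc (d : ℕ) : Type := EuclideanSpace ℝ (Fin d)

variable {d₁ d₂ : ℕ}

/-- The gradient of `H` in the momentum `p`. -/
def gradP (H : Euc d₁ → Euc d₂ → Euc d₁ → Euc d₂ → ℝ)
    (x : Euc d₁) (y : Euc d₂) (p : Euc d₁) (q : Euc d₂) : Euc d₁ :=
  gradient (fun p' => H x y p' q) p

/-- The gradient of `H` in the momentum `q`. -/
def gradQ (H : Euc d₁ → Euc d₂ → Euc d₁ → Euc d₂ → ℝ)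
    (x : Euc d₁) (y : Euc d₂) (p : Euc d₁) (q : Euc d₂) : Euc d₂ :=
  gradient (fun q' => H x y p q') q

/-- The standing assumptions on the Hamiltonian, with constants `C_H > 0` and `γ ≥ 1`. -/
structure IsHamiltonian (CH γ : ℝ) (H : Euc d₁ → Euc d₂ → Euc d₁ → Euc d₂ → ℝ) : Prop where
  const_pos : 0 < CH
  one_le_exponent : 1 ≤ γ
  contDiff : ContDiff ℝ 2
    (fun z : Euc d₁ × Euc d₂ × Euc d₁ × Euc d₂ => H z.1 z.2.1 z.2.2.1 z.2.2.2)
  nonneg : ∀ x y p q, 0 ≤ H x y p q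
  /-- The Hessian `∂²_pp H` is positive definite. -/
  hess_p_pos : ∀ x y p q, ∀ v : Euc d₁, v ≠ 0 →
    0 < iteratedFDeriv ℝ 2 (fun p' => H x y p' q) p ![v, v]
  /-- The Hessian `∂²_qq H` is positive definite. -/
  hess_q_pos : ∀ x y p q, ∀ v : Euc d₂, v ≠ 0 →
    0 < iteratedFDeriv ℝ 2 (fun q' => H x y p q') q ![v, v]
  /-- `|∂_y H| ≤ C_H (1 + |p|^γ + |q|^γ)`. -/
  grad_y_le : ∀ x y p q,
    ‖gradient (fun y' => H x y' p q) y‖ ≤ CH * (1 + ‖p‖ ^ γ + ‖q‖ ^ γ)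
  /-- `⟨∂_p H, p⟩ + ⟨∂_q H, q⟩ - H ≥ C_H⁻¹ (|p|^γ + |q|^γ) - C_H`. -/
  coercive : ∀ x y p q,
    CH⁻¹ * (‖p‖ ^ γ + ‖q‖ ^ γ) - CH ≤
      inner ℝ (gradP H x y p q) p + inner ℝ (gradQ H x y p q) q - H x y p q

/-- `∂_x u (t, x, y)`. -/
def gradX (u : ℝ → Euc d₁ → Euc d₂ → ℝ) (t : ℝ) (x : Euc d₁) (y : Euc d₂) : Euc d₁ :=
  gradient (fun x' => u t x' y) x

/-- `∂_y u (t, x, y)`. -/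
def gradY (u : ℝ → Euc d₁ → Euc d₂ → ℝ) (t : ℝ) (x : Euc d₁) (y : Euc d₂) : Euc d₂ :=
  gradient (fun y' => u t x y') y

/-- The full spatial Laplacian `Δ u = Δ_x u + Δ_y u`. -/
def spaceLaplacian (u : ℝ → Euc d₁ → Euc d₂ → ℝ) (t : ℝ) (x : Euc d₁) (y : Euc d₂) : ℝ :=
  Laplacian.laplacian (fun x' => u t x' y) x +
    Laplacian.laplacian (fun y' => u t x y') y

/-- Classical solutions on `[0, T]` of the Cauchy problem
`∂_t u - σ Δ u + H(x, y, ∂_x u, ∂_y u) = 0`, `u(0, ·, ·) = u₀`.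
Joint continuity of the derivatives is not asked for, so every `u` that is continuous on
`[0, T] × ℝ^d₁ × ℝ^d₂` and `C^{1,2}` on `(0, T) × ℝ^d₁ × ℝ^d₂` qualifies. -/
structure IsClassicalSolution (T σ : ℝ) (H : Euc d₁ → Euc d₂ → Euc d₁ → Euc d₂ → ℝ)
    (u₀ : Euc d₁ → Euc d₂ → ℝ) (u : ℝ → Euc d₁ → Euc d₂ → ℝ) : Prop where
  continuousOn : ContinuousOn (fun w : ℝ × Euc d₁ × Euc d₂ => u w.1 w.2.1 w.2.2)
    (Icc 0 T ×ˢ univ)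
  initial : ∀ x y, u 0 x y = u₀ x y
  contDiff_space : ∀ t ∈ Ioo 0 T, ContDiff ℝ 2 (fun z : Euc d₁ × Euc d₂ => u t z.1 z.2)
  differentiable_time : ∀ t ∈ Ioo 0 T, ∀ x y, DifferentiableAt ℝ (fun s => u s x y) t
  equation : ∀ t ∈ Ioo 0 T, ∀ x y,
    deriv (fun s => u s x y) t - σ * spaceLaplacian u t x y
      + H x y (gradX u t x y) (gradY u t x y) = 0

/-- `u` grows at most polynomially in space, uniformly on `[0, T]`. -/
def HasPolynomialGrowth (T : ℝ) (u : ℝ → Euc d₁ → Euc d₂ → ℝ) : Prop :=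
  ∃ (A : ℝ) (k : ℕ), ∀ t ∈ Icc 0 T, ∀ x y, |u t x y| ≤ A * (1 + ‖x‖ + ‖y‖) ^ k

/-- The velocity field `-(∂_p H, ∂_q H)(x, y, ∂_x u, ∂_y u)` that transports the Fokker-Planck
equation dual to the Hamilton-Jacobi equation points outwards at most linearly. -/
def HasNonexplosiveDrift (T : ℝ) (H : Euc d₁ → Euc d₂ → Euc d₁ → Euc d₂ → ℝ)
    (u : ℝ → Euc d₁ → Euc d₂ → ℝ) : Prop :=
  ∃ K : ℝ, ∀ t ∈ Ioo 0 T, ∀ x y,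
    -(inner ℝ (gradP H x y (gradX u t x y) (gradY u t x y)) x +
      inner ℝ (gradQ H x y (gradX u t x y) (gradY u t x y)) y) ≤ K * (1 + ‖x‖ ^ 2 + ‖y‖ ^ 2)

end

/-! Both bounds come from one minimum principle for linear drift-diffusion inequalities. With the
drift `b = (∂_p H, ∂_q H)` frozen along `u`, the equation reads `∂_t u - σ Δ u + ⟨b, ∇u⟩ = ⟨b, ∇u⟩ -
H`, which is at least `-C_H` by coercivity; hence `u ≥ -‖u₀‖ - C_H t`. Since `H ≥ 0`, `-u` is a
supersolution of the heat equation; hence `u ≤ ‖u₀‖`.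

On the unbounded domain the principle (`IsDriftSupersolution.ge_sub`) is proved by adding `ε e^{λt}
(1 + |x|² + |y|²)^(k+1)`. This beats growth of degree `k`, so a minimum below the initial bound
would be attained, and for large `λ` the conditions at a minimum contradict the inequality
(`perturbation_not_min`). Only `λ` depends on `σ` and `K`, and it disappears as `ε → 0`. -/

theorem IsLocalMin.deriv_deriv_nonneg {h : ℝ → ℝ} {s : ℝ} (hmin : IsLocalMin h s)
    (hc : ContinuousAt h s) : 0 ≤ deriv (deriv h) s := by
  by_contra! hneg
  -- If `h'' < 0`, the point is also a local maximum, so `h` is locally constant.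
  have hmax := isLocalMax_of_deriv_deriv_neg hneg hmin.deriv_eq_zero hc
  have heq : h =ᶠ[nhds s] fun _ => h s := by
    filter_upwards [hmin, hmax] with r h1 h2 using le_antisymm h2 h1
  have h0 : deriv (deriv h) s = 0 := by
    rw [(heq.deriv).deriv_eq]
    simp
  exact hneg.ne h0

/-! ### Optimality conditions for a function perturbed by a power of `a + ‖·‖²` -/

section Perturbation

variable {E : Type*} [NormedAddCommGroup E] [InnerProductSpace ℝ E]

theorem hasDerivAt_comp_line {g : E → ℝ} (hg : Differentiable ℝ g) (x e : E) (s : ℝ) :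
    HasDerivAt (fun s : ℝ => g (x + s • e)) (fderiv ℝ g (x + s • e) e) s := by
  have hline : HasDerivAt (fun s : ℝ => x + s • e) e s := by
    simpa using ((hasDerivAt_id s).smul_const e).const_add x
  exact (hg _).hasFDerivAt.comp_hasDerivAt s hline

theorem hasDerivAt_fderiv_comp_line {g : E → ℝ} (hg : ContDiff ℝ 2 g) (x e : E) :
    HasDerivAt (fun s : ℝ => fderiv ℝ g (x + s • e) e) (iteratedFDeriv ℝ 2 g x ![e, e]) 0 := by
  have hd : Differentiable ℝ (fderiv ℝ g) :=
    (hg.fderiv_right (m := 1) (by norm_num)).differentiable (by norm_num)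
  have hline : HasDerivAt (fun s : ℝ => x + s • e) e 0 := by
    simpa using ((hasDerivAt_id (0 : ℝ)).smul_const e).const_add x
  have h1 := (hd (x + (0 : ℝ) • e)).hasFDerivAt.comp_hasDerivAt (0 : ℝ) hline
  have h2 := h1.clm_apply (hasDerivAt_const (0 : ℝ) e)
  simpa [iteratedFDeriv_two_apply] using h2

theorem add_norm_sq_line (a : ℝ) (x e : E) (s : ℝ) :
    a + ‖x + s • e‖ ^ 2 = a + ‖x‖ ^ 2 + 2 * inner ℝ x e * s + ‖e‖ ^ 2 * s ^ 2 := by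
  rw [norm_add_sq_real, inner_smul_right, norm_smul, mul_pow, Real.norm_eq_abs, sq_abs]
  ring

theorem hasDerivAt_quadratic_pow (W b c s : ℝ) (k : ℕ) :
    HasDerivAt (fun s : ℝ => (W + 2 * b * s + c * s ^ 2) ^ (k + 1))
      ((k + 1) * (W + 2 * b * s + c * s ^ 2) ^ k * (2 * b + 2 * c * s)) s := by
  have h1 : HasDerivAt (fun s : ℝ => W + 2 * b * s + c * s ^ 2) (2 * b + 2 * c * s) s := by
    have := (((hasDerivAt_id s).const_mul (2 * b)).const_add W).add
      (((hasDerivAt_id s).pow 2).const_mul c)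
    refine this.congr_deriv ?_
    simp
    ring
  refine (h1.pow (k + 1)).congr_deriv ?_
  simp

variable {g : E → ℝ} {x : E} {a κ : ℝ} {k : ℕ}

/-- First and second order conditions at a minimum of `g + κ (a + ‖·‖²) ^ (k + 1)`. -/
theorem line_conditions_of_min (hg : ContDiff ℝ 2 g)
    (hmin : ∀ x', g x + κ * (a + ‖x‖ ^ 2) ^ (k + 1) ≤ g x' + κ * (a + ‖x'‖ ^ 2) ^ (k + 1))
    (e : E) :
    fderiv ℝ g x e = -(κ * ((k + 1) * (a + ‖x‖ ^ 2) ^ k * (2 * inner ℝ x e))) ∧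
    -(κ * ((k + 1) * (k * (a + ‖x‖ ^ 2) ^ (k - 1) * (2 * inner ℝ x e) * (2 * inner ℝ x e)
      + (a + ‖x‖ ^ 2) ^ k * (2 * ‖e‖ ^ 2)))) ≤ iteratedFDeriv ℝ 2 g x ![e, e] := by
  set W := a + ‖x‖ ^ 2 with hW
  set b : ℝ := inner ℝ x e with hb
  set c := ‖e‖ ^ 2 with hc
  set h : ℝ → ℝ := fun s => g (x + s • e) + κ * (W + 2 * b * s + c * s ^ 2) ^ (k + 1) with hh
  have hloc : IsLocalMin h 0 := by
    refine Filter.Eventually.of_forall fun s => ?_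
    have := hmin (x + s • e)
    rw [add_norm_sq_line] at this
    simpa [hh] using this
  have hd : ∀ s, HasDerivAt h (fderiv ℝ g (x + s • e) e +
      κ * ((k + 1) * (W + 2 * b * s + c * s ^ 2) ^ k * (2 * b + 2 * c * s))) s := fun s =>
    (hasDerivAt_comp_line (hg.differentiable (by norm_num)) x e s).add
      ((hasDerivAt_quadratic_pow W b c s k).const_mul κ)
  have hd2 : HasDerivAt (deriv h) (iteratedFDeriv ℝ 2 g x ![e, e] +
      κ * ((k + 1) * (k * W ^ (k - 1) * (2 * b) * (2 * b) + W ^ k * (2 * c)))) 0 := by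
    rw [show deriv h = _ from funext fun s => (hd s).deriv]
    refine (hasDerivAt_fderiv_comp_line hg x e).add (HasDerivAt.const_mul κ ?_)
    have hq : HasDerivAt (fun s : ℝ => W + 2 * b * s + c * s ^ 2) (2 * b) 0 := by
      simpa using hasDerivAt_quadratic_pow W b c 0 0
    have hl : HasDerivAt (fun s : ℝ => 2 * b + 2 * c * s) (2 * c) 0 := by
      simpa using ((hasDerivAt_id (0 : ℝ)).const_mul (2 * c)).const_add (2 * b)
    refine (((hq.pow k).const_mul ((k : ℝ) + 1)).mul hl).congr_deriv ?_
    simp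
    ring
  constructor
  · have := hloc.hasDerivAt_eq_zero (hd 0)
    simp only [zero_smul, add_zero, mul_zero, ne_eq, OfNat.ofNat_ne_zero, not_false_eq_true,
      zero_pow] at this
    linarith
  · have := hloc.deriv_deriv_nonneg (hd 0).continuousAt
    rw [hd2.deriv] at this
    linarith

variable [FiniteDimensional ℝ E]

theorem inner_gradient_of_min (hg : ContDiff ℝ 2 g)
    (hmin : ∀ x', g x + κ * (a + ‖x‖ ^ 2) ^ (k + 1) ≤ g x' + κ * (a + ‖x'‖ ^ 2) ^ (k + 1))
    (e : E) :
    inner ℝ e (gradient g x) = -(κ * (2 * (k + 1) * (a + ‖x‖ ^ 2) ^ k)) * inner ℝ e x := by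
  rw [inner_gradient_right, (line_conditions_of_min hg hmin e).1, real_inner_comm]
  simp
  ring

/-- Sums the second-order condition over an orthonormal basis. By Cauchy-Schwarz `⟨x, e⟩² ≤ W`, and
`W ≥ 1` absorbs every term into `W ^ (k + 1)`. In the application `a` is `1` plus the squared norm
of the frozen variable. -/
theorem laplacian_ge_of_min (ha : 1 ≤ a) (hκ : 0 ≤ κ) (hg : ContDiff ℝ 2 g)
    (hmin : ∀ x', g x + κ * (a + ‖x‖ ^ 2) ^ (k + 1) ≤ g x' + κ * (a + ‖x'‖ ^ 2) ^ (k + 1)) :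
    -(Module.finrank ℝ E * (κ * ((k + 1) * (4 * k + 2)) * (a + ‖x‖ ^ 2) ^ (k + 1))) ≤
      Laplacian.laplacian g x := by
  have hW : 1 ≤ a + ‖x‖ ^ 2 := by nlinarith [sq_nonneg ‖x‖]
  set W := a + ‖x‖ ^ 2 with hWdef
  have hW0 : 0 ≤ W := by linarith
  have key : ∀ i, -(κ * ((k + 1) * (4 * k + 2)) * W ^ (k + 1)) ≤
      iteratedFDeriv ℝ 2 g x ![stdOrthonormalBasis ℝ E i, stdOrthonormalBasis ℝ E i] := by
    intro i
    set e := stdOrthonormalBasis ℝ E i with he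
    have hn : ‖e‖ = 1 := (stdOrthonormalBasis ℝ E).orthonormal.1 i
    have h2 := (line_conditions_of_min hg hmin e).2
    rw [← hWdef, hn] at h2
    have hb : (inner ℝ x e : ℝ) ^ 2 ≤ W := by
      have := abs_real_inner_le_norm x e
      rw [hn, mul_one] at this
      have := pow_le_pow_left₀ (abs_nonneg _) this 2
      rw [sq_abs] at this
      linarith
    -- The truncated exponent at `k = 0` is harmless because of the factor `k`.
    have hk : (k : ℝ) * W ^ (k - 1) * W ≤ k * W ^ (k + 1) := by
      rcases k.eq_zero_or_pos with rfl | hk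
      · simp
      · rw [mul_assoc, ← pow_succ, Nat.sub_add_cancel hk]
        gcongr
        · omega
    have hk' : (k : ℝ) * W ^ (k - 1) * (inner ℝ x e : ℝ) ^ 2 ≤ k * W ^ (k - 1) * W := by
      gcongr
    have hk2 : W ^ k ≤ W ^ (k + 1) := pow_le_pow_right₀ hW (by omega)
    refine le_trans (neg_le_neg ?_) h2
    have : (k : ℝ) * W ^ (k - 1) * (2 * inner ℝ x e) * (2 * inner ℝ x e)
      + W ^ k * (2 * 1 ^ 2) ≤ (4 * k + 2) * W ^ (k + 1) := by nlinarith
    calc _ ≤ κ * ((k + 1) * ((4 * k + 2) * W ^ (k + 1))) := by gcongr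
      _ = _ := by ring
  rw [InnerProductSpace.laplacian_eq_iteratedFDeriv_stdOrthonormalBasis]
  calc _ = ∑ _i : Fin (Module.finrank ℝ E), -(κ * ((k + 1) * (4 * k + 2)) * W ^ (k + 1)) := by
        simp
    _ ≤ _ := Finset.sum_le_sum fun i _ => key i

end Perturbation

/-! ### Minimum principle on the whole space -/

theorem deriv_nonpos_of_left_min {h : ℝ → ℝ} {h' t : ℝ} (ht : 0 < t) (hd : HasDerivAt h h' t)
    (hmin : ∀ s ∈ Icc 0 t, h t ≤ h s) : h' ≤ 0 := by
  have hloc : IsLocalMinOn h (Icc 0 t) t :=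
    Filter.eventually_of_mem self_mem_nhdsWithin hmin
  have hmem : (0 : ℝ) - t ∈ posTangentConeAt (Icc 0 t) t := by
    apply sub_mem_posTangentConeAt_of_segment_subset
    exact (convex_Icc 0 t).segment_subset (right_mem_Icc.2 ht.le) (left_mem_Icc.2 ht.le)
  have := hloc.hasFDerivWithinAt_nonneg hd.hasFDerivAt.hasFDerivWithinAt hmem
  simp at this
  nlinarith

/-- Supersolutions of `∂_t v - σ Δ v + ⟨b, ∇ v⟩ = -c` of class `C^{1,2}` and polynomial growth,
where the transport `-b` points outwards at most linearly. -/
structure IsDriftSupersolution {d₁ d₂ : ℕ} (T σ c K : ℝ) (b₁ : ℝ → Euc d₁ → Euc d₂ → Euc d₁)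
    (b₂ : ℝ → Euc d₁ → Euc d₂ → Euc d₂) (v : ℝ → Euc d₁ → Euc d₂ → ℝ) : Prop where
  continuousOn : ContinuousOn (fun w : ℝ × Euc d₁ × Euc d₂ => v w.1 w.2.1 w.2.2)
    (Icc 0 T ×ˢ univ)
  growth : HasPolynomialGrowth T v
  contDiff_space : ∀ t ∈ Ioo 0 T, ContDiff ℝ 2 (fun z : Euc d₁ × Euc d₂ => v t z.1 z.2)
  differentiable_time : ∀ t ∈ Ioo 0 T, ∀ x y, DifferentiableAt ℝ (fun s => v s x y) t
  drift : ∀ t ∈ Ioo 0 T, ∀ x y,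
    -(inner ℝ (b₁ t x y) x + inner ℝ (b₂ t x y) y) ≤ K * (1 + ‖x‖ ^ 2 + ‖y‖ ^ 2)
  supersolution : ∀ t ∈ Ioo 0 T, ∀ x y,
    -c ≤ deriv (fun s => v s x y) t - σ * spaceLaplacian v t x y
      + (inner ℝ (b₁ t x y) (gradX v t x y) + inner ℝ (b₂ t x y) (gradY v t x y))

namespace IsDriftSupersolution

variable {d₁ d₂ : ℕ} {T σ c K : ℝ} {b₁ : ℝ → Euc d₁ → Euc d₂ → Euc d₁}
  {b₂ : ℝ → Euc d₁ → Euc d₂ → Euc d₂} {v : ℝ → Euc d₁ → Euc d₂ → ℝ}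

/-- The perturbation of a supersolution by a Lyapunov function has no spatial minimum at a
positive time that is also minimal among earlier times. -/
theorem perturbation_not_min (hv : IsDriftSupersolution T σ c K b₁ b₂ v) (hσ : 0 ≤ σ)
    {ε lam : ℝ} (hε : 0 < ε) {k : ℕ}
    (hlam : 2 * (k + 1) * |K| + σ * (d₁ + d₂) * ((k + 1) * (4 * k + 2)) < lam)
    {t : ℝ} (ht : t ∈ Ioo 0 T) (x : Euc d₁) (y : Euc d₂)
    (hmin : ∀ s ∈ Icc 0 t, ∀ x' y',
      v t x y + c * t + ε * Real.exp (lam * t) * (1 + ‖x‖ ^ 2 + ‖y‖ ^ 2) ^ (k + 1) ≤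
      v s x' y' + c * s + ε * Real.exp (lam * s) * (1 + ‖x'‖ ^ 2 + ‖y'‖ ^ 2) ^ (k + 1)) :
    False := by
  have htt : t ∈ Icc 0 t := right_mem_Icc.2 ht.1.le
  set κ := ε * Real.exp (lam * t) with hκdef
  have hκ : 0 < κ := mul_pos hε (Real.exp_pos _)
  set W := 1 + ‖x‖ ^ 2 + ‖y‖ ^ 2 with hW
  have hW1 : 1 ≤ W := by nlinarith [sq_nonneg ‖x‖, sq_nonneg ‖y‖]
  have hW0 : 0 < W := by linarith
  have hWx : 1 + ‖y‖ ^ 2 + ‖x‖ ^ 2 = W := by rw [hW]; ring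
  have hcx : ContDiff ℝ 2 (fun x' => v t x' y) :=
    (hv.contDiff_space t ht).comp (contDiff_id.prodMk contDiff_const)
  have hcy : ContDiff ℝ 2 (fun y' => v t x y') :=
    (hv.contDiff_space t ht).comp (contDiff_const.prodMk contDiff_id)
  have hmx : ∀ x', v t x y + κ * (1 + ‖y‖ ^ 2 + ‖x‖ ^ 2) ^ (k + 1) ≤
      v t x' y + κ * (1 + ‖y‖ ^ 2 + ‖x'‖ ^ 2) ^ (k + 1) := by
    intro x'
    have := hmin t htt x' y
    rw [hWx, show 1 + ‖y‖ ^ 2 + ‖x'‖ ^ 2 = 1 + ‖x'‖ ^ 2 + ‖y‖ ^ 2 by ring]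
    linarith
  have hmy : ∀ y', v t x y + κ * (1 + ‖x‖ ^ 2 + ‖y‖ ^ 2) ^ (k + 1) ≤
      v t x y' + κ * (1 + ‖x‖ ^ 2 + ‖y'‖ ^ 2) ^ (k + 1) := by
    intro y'
    have := hmin t htt x y'
    linarith
  have hgx : inner ℝ (b₁ t x y) (gradX v t x y) = _ :=
    inner_gradient_of_min (g := fun x' => v t x' y) hcx hmx (b₁ t x y)
  have hgy : inner ℝ (b₂ t x y) (gradY v t x y) = _ :=
    inner_gradient_of_min (g := fun y' => v t x y') hcy hmy (b₂ t x y)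
  have hlx := laplacian_ge_of_min (by nlinarith [sq_nonneg ‖y‖]) hκ.le hcx hmx
  have hly := laplacian_ge_of_min (by nlinarith [sq_nonneg ‖x‖]) hκ.le hcy hmy
  rw [finrank_euclideanSpace_fin] at hlx hly
  rw [hWx] at hgx hlx
  rw [← hW] at hgy hly
  -- Growth of `e^{λs}` contributes the term in `lam` that must dominate the drift and the
  -- diffusion.
  have htime : deriv (fun s => v s x y) t + c + κ * lam * W ^ (k + 1) ≤ 0 := by
    have hexp : HasDerivAt (fun s => Real.exp (lam * s)) (Real.exp (lam * t) * lam) t := by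
      simpa using ((hasDerivAt_id t).const_mul lam).exp
    have hd := (((hv.differentiable_time t ht x y).hasDerivAt).add
      ((hasDerivAt_id t).const_mul c)).add ((hexp.const_mul ε).mul_const (W ^ (k + 1)))
    have := deriv_nonpos_of_left_min ht.1 hd fun s hs => hmin s hs x y
    rw [hκdef]
    linarith
  have hsup := hv.supersolution t ht x y
  have hdr := hv.drift t ht x y
  have hK : -(inner ℝ (b₁ t x y) x + inner ℝ (b₂ t x y) y) ≤ |K| * W :=
    hdr.trans (by gcongr; exact le_abs_self K)
  have hlap : -(σ * spaceLaplacian v t x y) ≤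
      κ * W ^ (k + 1) * (σ * (d₁ + d₂) * ((k + 1) * (4 * k + 2))) := by
    have : -spaceLaplacian v t x y ≤
        κ * W ^ (k + 1) * ((d₁ + d₂) * ((k + 1) * (4 * k + 2))) := by
      rw [spaceLaplacian]
      linarith
    calc -(σ * spaceLaplacian v t x y) = σ * -spaceLaplacian v t x y := by ring
      _ ≤ σ * (κ * W ^ (k + 1) * ((d₁ + d₂) * ((k + 1) * (4 * k + 2)))) := by gcongr
      _ = _ := by ring
  have htrans : inner ℝ (b₁ t x y) (gradX v t x y) + inner ℝ (b₂ t x y) (gradY v t x y) ≤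
      κ * W ^ (k + 1) * (2 * (k + 1) * |K|) := by
    rw [hgx, hgy]
    -- At the minimum `∇v` is a nonpositive multiple of the position, so a one-sided bound on the
    -- radial drift suffices.
    calc _ = κ * (2 * (k + 1) * W ^ k) *
          -(inner ℝ (b₁ t x y) x + inner ℝ (b₂ t x y) y) := by ring
      _ ≤ κ * (2 * (k + 1) * W ^ k) * (|K| * W) := by gcongr
      _ = _ := by ring
  have hpos : 0 < κ * W ^ (k + 1) := by positivity
  have := mul_lt_mul_of_pos_left hlam hpos
  linarith

/-- A value below `m` would force a global minimum over `[0, t]` inside a compact set: time `0` is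
excluded by the initial bound, positive times by `perturbation_not_min`. -/
theorem perturbation_ge (hv : IsDriftSupersolution T σ c K b₁ b₂ v) (hσ : 0 ≤ σ)
    {m : ℝ} (hm : ∀ x y, m ≤ v 0 x y) {A : ℝ} {k : ℕ}
    (hA : ∀ t ∈ Icc 0 T, ∀ x y, |v t x y| ≤ A * (1 + ‖x‖ + ‖y‖) ^ k)
    {ε lam : ℝ} (hε : 0 < ε)
    (hlam : 2 * (k + 1) * |K| + σ * (d₁ + d₂) * ((k + 1) * (4 * k + 2)) < lam)
    {t : ℝ} (ht : t ∈ Ioo 0 T) (x : Euc d₁) (y : Euc d₂) :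
    m ≤ v t x y + c * t + ε * Real.exp (lam * t) * (1 + ‖x‖ ^ 2 + ‖y‖ ^ 2) ^ (k + 1) := by
  by_contra! hlt
  set f : ℝ × Euc d₁ × Euc d₂ → ℝ := fun w => v w.1 w.2.1 w.2.2 + c * w.1 +
    ε * Real.exp (lam * w.1) * (1 + ‖w.2.1‖ ^ 2 + ‖w.2.2‖ ^ 2) ^ (k + 1) with hf
  have hlam0 : 0 ≤ lam := le_trans (by positivity) hlam.le
  have hsub : Icc 0 t ⊆ Icc 0 T := Icc_subset_Icc_right ht.2.le
  have hfc : ContinuousOn f (Icc 0 t ×ˢ univ) := by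
    refine ((hv.continuousOn.mono (prod_mono_left hsub)).add ?_).add ?_ <;> fun_prop
  set B := |A| * 2 ^ k with hB
  -- Chosen so that `W ≥ R` makes the perturbation dominate `B * W ^ k + |c| * T + |m|`; the `2 ^ k`
  -- in `B` comes from `1 + ‖x‖ + ‖y‖ ≤ 2 * W`.
  set R := 1 + (B + |c| * T + |m|) / ε with hR
  have hT : 0 ≤ T := ht.1.le.trans ht.2.le
  have hB0 : 0 ≤ B := by positivity
  have hR1 : 1 ≤ R := by
    have : 0 ≤ (B + |c| * T + |m|) / ε := by positivity
    linarith
  have hεR : B + |c| * T + |m| ≤ ε * R := by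
    rw [hR, mul_add, mul_div_cancel₀ _ hε.ne']
    linarith
  have hcoer : ∀ w : ℝ × Euc d₁ × Euc d₂, w.1 ∈ Icc 0 t →
      R ≤ 1 + ‖w.2.1‖ ^ 2 + ‖w.2.2‖ ^ 2 → m ≤ f w := by
    rintro ⟨s, x', y'⟩ hs hRW
    simp only at hs hRW
    set W := 1 + ‖x'‖ ^ 2 + ‖y'‖ ^ 2 with hW
    have hW1 : 1 ≤ W := hR1.trans hRW
    have hWk : 1 ≤ W ^ k := one_le_pow₀ hW1
    have hv1 : |v s x' y'| ≤ B * W ^ k := by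
      calc |v s x' y'| ≤ A * (1 + ‖x'‖ + ‖y'‖) ^ k := hA s (hsub hs) x' y'
        _ ≤ |A| * (2 * W) ^ k := by
          gcongr
          · exact le_abs_self A
          · nlinarith [sq_nonneg (‖x'‖ - 1), sq_nonneg (‖y'‖ - 1), sq_nonneg ‖x'‖,
              sq_nonneg ‖y'‖]
        _ = B * W ^ k := by rw [hB, mul_pow]; ring
    have hcs : |c * s| ≤ |c| * T := by
      rw [abs_mul, abs_of_nonneg hs.1]
      exact mul_le_mul_of_nonneg_left (hsub hs).2 (abs_nonneg c)
    have hexp : 1 ≤ Real.exp (lam * s) := Real.one_le_exp (mul_nonneg hlam0 hs.1)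
    have h1 : (B + |c| * T + |m|) * W ^ k ≤ ε * Real.exp (lam * s) * W ^ (k + 1) := by
      calc (B + |c| * T + |m|) * W ^ k ≤ ε * W * W ^ k := by
            gcongr
            exact hεR.trans (by gcongr)
        _ = ε * 1 * W ^ (k + 1) := by ring
        _ ≤ _ := by gcongr
    have h2 : |c| * T + |m| ≤ (|c| * T + |m|) * W ^ k :=
      le_mul_of_one_le_right (by positivity) hWk
    change m ≤ v s x' y' + c * s + ε * Real.exp (lam * s) * W ^ (k + 1)
    linarith [neg_abs_le (v s x' y'), neg_abs_le (c * s), le_abs_self m]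
  -- The same `R` serves as radius: since `R ≥ 1`, a norm above `R` gives `W ≥ R ^ 2 ≥ R`.
  set S : Set (ℝ × Euc d₁ × Euc d₂) :=
    Icc 0 t ×ˢ (Metric.closedBall 0 R ×ˢ Metric.closedBall 0 R) with hS
  have hScomp : IsCompact S :=
    isCompact_Icc.prod ((isCompact_closedBall _ _).prod (isCompact_closedBall _ _))
  have houts : ∀ w : ℝ × Euc d₁ × Euc d₂, w.1 ∈ Icc 0 t → w ∉ S → m ≤ f w := by
    rintro ⟨s, x', y'⟩ hs hw
    apply hcoer _ hs
    simp only [hS, mem_prod, hs, true_and, mem_closedBall_zero_iff, not_and_or, not_le] at hw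
    change R ≤ 1 + ‖x'‖ ^ 2 + ‖y'‖ ^ 2
    rcases hw with hw | hw <;> nlinarith [sq_nonneg ‖x'‖, sq_nonneg ‖y'‖]
  have htt : t ∈ Icc 0 t := right_mem_Icc.2 ht.1.le
  have hmemS : (t, x, y) ∈ S := by
    by_contra hw
    exact absurd (houts _ htt hw) (not_le.2 hlt)
  obtain ⟨⟨t', x', y'⟩, hwS, hwmin⟩ := hScomp.exists_isMinOn ⟨_, hmemS⟩
    (hfc.mono (prod_mono_right (subset_univ _)))
  have hflt : f (t', x', y') < m := lt_of_le_of_lt (hwmin hmemS) hlt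
  have ht' : t' ∈ Icc 0 t := hwS.1
  have hglob : ∀ w : ℝ × Euc d₁ × Euc d₂, w.1 ∈ Icc 0 t → f (t', x', y') ≤ f w := by
    intro w hw
    by_cases hwS' : w ∈ S
    · exact hwmin hwS'
    · exact hflt.le.trans (houts w hw hwS')
  rcases ht'.1.eq_or_lt with h0 | h0
  · subst h0
    have h1 := hm x' y'
    have h2 : 0 ≤ ε * Real.exp (lam * 0) * (1 + ‖x'‖ ^ 2 + ‖y'‖ ^ 2) ^ (k + 1) := by positivity
    simp only [hf] at hflt
    linarith
  · exact hv.perturbation_not_min hσ hε hlam ⟨h0, ht'.2.trans_lt ht.2⟩ x' y'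
      fun s hs x'' y'' => hglob (s, x'', y'') ⟨hs.1, hs.2.trans ht'.2⟩

/-- The minimum principle for supersolutions of polynomial growth. -/
theorem ge_sub (hv : IsDriftSupersolution T σ c K b₁ b₂ v) (hT : 0 < T) (hσ : 0 ≤ σ)
    {m : ℝ} (hm : ∀ x y, m ≤ v 0 x y) {t : ℝ} (ht : t ∈ Icc 0 T) (x : Euc d₁) (y : Euc d₂) :
    m - c * t ≤ v t x y := by
  have hopen : ∀ t ∈ Ioo 0 T, m - c * t ≤ v t x y := by
    intro t ht
    obtain ⟨A, k, hA⟩ := hv.growth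
    obtain ⟨lam, hlam⟩ :=
      exists_gt (2 * (k + 1) * |K| + σ * (d₁ + d₂) * ((k + 1) * (4 * k + 2)))
    set P := Real.exp (lam * t) * (1 + ‖x‖ ^ 2 + ‖y‖ ^ 2) ^ (k + 1) with hP
    have hP0 : 0 < P := by positivity
    -- Taking `ε = δ / P` makes the perturbation at this point equal to `δ`; this is possible
    -- because `lam` does not depend on `ε`.
    refine le_of_forall_pos_le_add fun δ hδ => ?_
    have := hv.perturbation_ge hσ hm hA (div_pos hδ hP0) hlam ht x y
    rw [mul_assoc, ← hP, div_mul_cancel₀ _ hP0.ne'] at this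
    linarith
  -- The inequality holds only at interior times, so the endpoints are reached by continuity.
  have hcv : ContinuousOn (fun s => v s x y) (Icc 0 T) :=
    hv.continuousOn.comp (f := fun s : ℝ => (s, x, y)) (by fun_prop) fun s hs => ⟨hs, trivial⟩
  have hcl : closure (Ioo 0 T) = Icc 0 T := closure_Ioo hT.ne
  exact le_on_closure (s := Ioo 0 T) (f := fun t => m - c * t) (g := fun t => v t x y) hopen
    (by fun_prop) (hcl ▸ hcv) (hcl ▸ ht)

end IsDriftSupersolution

/-! ### Two-sided bound for the Hamilton-Jacobi equation -/

section Solutions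

variable {d₁ d₂ : ℕ} {T σ CH γ : ℝ} {H : Euc d₁ → Euc d₂ → Euc d₁ → Euc d₂ → ℝ}
  {u₀ : Euc d₁ → Euc d₂ → ℝ} {u : ℝ → Euc d₁ → Euc d₂ → ℝ}

/-- Nonnegativity of `H` alone yields the upper bound on `u`, with no drift and no loss in time. -/
theorem IsClassicalSolution.isDriftSupersolution_neg (hH : IsHamiltonian CH γ H)
    (hu : IsClassicalSolution T σ H u₀ u) (hg : HasPolynomialGrowth T u) :
    IsDriftSupersolution T σ 0 0 (fun _ _ _ => 0) (fun _ _ _ => 0) (fun t x y => -u t x y) where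
  continuousOn := hu.continuousOn.neg
  growth := by simpa [HasPolynomialGrowth] using hg
  contDiff_space t ht := (hu.contDiff_space t ht).neg
  differentiable_time t ht x y := (hu.differentiable_time t ht x y).neg
  drift := by simp
  supersolution t ht x y := by
    have hlap : spaceLaplacian (fun t x y => -u t x y) t x y = -spaceLaplacian u t x y := by
      have h1 := congrFun (InnerProductSpace.laplacian_neg (f := fun x' => u t x' y)) x
      have h2 := congrFun (InnerProductSpace.laplacian_neg (f := fun y' => u t x y')) y
      simp only [Pi.neg_apply] at h1 h2
      rw [spaceLaplacian, spaceLaplacian, neg_add, ← h1, ← h2]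
      rfl
    have heq := hu.equation t ht x y
    have hnn := hH.nonneg x y (gradX u t x y) (gradY u t x y)
    rw [hlap, deriv.fun_neg]
    simp only [inner_zero_left]
    linarith

/-- Coercivity at the momenta `∇u` bounds `⟨b, ∇u⟩ - H` below by `-CH`, once the nonnegative power
terms are dropped. -/
theorem IsClassicalSolution.isDriftSupersolution (hH : IsHamiltonian CH γ H)
    (hu : IsClassicalSolution T σ H u₀ u) (hg : HasPolynomialGrowth T u) {K : ℝ}
    (hK : ∀ t ∈ Ioo 0 T, ∀ x y,
      -(inner ℝ (gradP H x y (gradX u t x y) (gradY u t x y)) x +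
        inner ℝ (gradQ H x y (gradX u t x y) (gradY u t x y)) y) ≤
          K * (1 + ‖x‖ ^ 2 + ‖y‖ ^ 2)) :
    IsDriftSupersolution T σ CH K (fun t x y => gradP H x y (gradX u t x y) (gradY u t x y))
      (fun t x y => gradQ H x y (gradX u t x y) (gradY u t x y)) u where
  continuousOn := hu.continuousOn
  growth := hg
  contDiff_space := hu.contDiff_space
  differentiable_time := hu.differentiable_time
  drift := hK
  supersolution t ht x y := by
    have heq := hu.equation t ht x y
    have hco := hH.coercive x y (gradX u t x y) (gradY u t x y)
    have hCH := hH.const_pos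
    have hnn : 0 ≤ CH⁻¹ * (‖gradX u t x y‖ ^ γ + ‖gradY u t x y‖ ^ γ) := by positivity
    linarith

theorem IsClassicalSolution.abs_le_add (hT : 0 < T) (hσ : 0 ≤ σ) (hH : IsHamiltonian CH γ H)
    (hu : IsClassicalSolution T σ H u₀ u) (hg : HasPolynomialGrowth T u)
    (hd : HasNonexplosiveDrift T H u) {M : ℝ} (hM : ∀ x y, |u₀ x y| ≤ M)
    {t : ℝ} (ht : t ∈ Icc 0 T) (x : Euc d₁) (y : Euc d₂) : |u t x y| ≤ M + CH * t := by
  obtain ⟨K, hK⟩ := hd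
  have hlow := (hu.isDriftSupersolution hH hg hK).ge_sub hT hσ (m := -M)
    (fun x y => by rw [hu.initial]; exact (abs_le.1 (hM x y)).1) ht x y
  have hup := (hu.isDriftSupersolution_neg hH hg).ge_sub hT hσ (m := -M)
    (fun x y => by rw [hu.initial]; exact neg_le_neg (abs_le.1 (hM x y)).2) ht x y
  have := mul_nonneg hH.const_pos.le ht.1
  rw [abs_le]
  constructor <;> linarith

end Solutions

/-! ### From pointwise bounds to essential suprema -/

/-- The inequality holds almost everywhere, hence on a dense set, and continuity makes that set
closed. -/
theorem enorm_le_eLpNorm_top_of_continuous {X F : Type*} [TopologicalSpace X] [MeasurableSpace X]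
    [NormedAddCommGroup F] {μ : Measure X} [μ.IsOpenPosMeasure] {f : X → F} (hf : Continuous f)
    (x : X) : ‖f x‖ₑ ≤ eLpNorm f ∞ μ := by
  have hdense : Dense {x | ‖f x‖ₑ ≤ eLpNorm f ∞ μ} := by
    rw [eLpNorm_exponent_top]
    exact Measure.dense_of_ae ae_le_eLpNormEssSup
  have hclosed : IsClosed {x | ‖f x‖ₑ ≤ eLpNorm f ∞ μ} :=
    isClosed_le hf.enorm continuous_const
  exact eq_univ_iff_forall.1 (hclosed.closure_eq ▸ hdense.closure_eq) x

theorem mainTheorem7 {d₁ d₂ : ℕ} {T CH γ : ℝ} (hT : 0 < T)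
    {H : Euc d₁ → Euc d₂ → Euc d₁ → Euc d₂ → ℝ} (hH : IsHamiltonian CH γ H)
    {u₀ : Euc d₁ → Euc d₂ → ℝ} (hu₀_bdd : ∃ M : ℝ, ∀ x y, |u₀ x y| ≤ M)
    (hu₀_lip : ∃ L, LipschitzWith L (fun z : Euc d₁ × Euc d₂ => u₀ z.1 z.2))
    {σ : ℝ} (hσ : 0 < σ) {u : ℝ → Euc d₁ → Euc d₂ → ℝ}
    (hu : IsClassicalSolution T σ H u₀ u) (hu_growth : HasPolynomialGrowth T u)
    (hu_drift : HasNonexplosiveDrift T H u) :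
    ⨆ t ∈ Icc (0 : ℝ) T, eLpNorm (fun z : Euc d₁ × Euc d₂ => u t z.1 z.2) ∞ volume ≤
      eLpNorm (fun z : Euc d₁ × Euc d₂ => u₀ z.1 z.2) ∞ volume + ENNReal.ofReal (CH * T) := by
  have hcont : Continuous fun z : Euc d₁ × Euc d₂ => u₀ z.1 z.2 := hu₀_lip.choose_spec.continuous
  obtain ⟨M, hM⟩ := hu₀_bdd
  set N := eLpNorm (fun z : Euc d₁ × Euc d₂ => u₀ z.1 z.2) ∞ volume with hN
  have hNfin : N ≠ ∞ := by
    have : N ≤ ENNReal.ofReal M := by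
      rw [hN, eLpNorm_exponent_top]
      exact eLpNormEssSup_le_of_ae_bound (Filter.Eventually.of_forall fun z => hM z.1 z.2)
    exact ne_top_of_le_ne_top ENNReal.ofReal_ne_top this
  -- The minimum principle needs the initial bound at every point, so the essential supremum is
  -- upgraded by continuity of `u₀`.
  have hbound : ∀ x y, |u₀ x y| ≤ N.toReal := by
    intro x y
    have := enorm_le_eLpNorm_top_of_continuous (μ := volume) hcont (x, y)
    have := ENNReal.toReal_mono hNfin this
    simpa using this
  refine iSup₂_le fun t ht => ?_
  have hCHT : CH * t ≤ CH * T := mul_le_mul_of_nonneg_left ht.2 hH.const_pos.le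
  have hle : ∀ z : Euc d₁ × Euc d₂, ‖u t z.1 z.2‖ ≤ N.toReal + CH * T := fun z =>
    (hu.abs_le_add hT hσ.le hH hu_growth hu_drift hbound ht z.1 z.2).trans (by linarith)
  calc eLpNorm (fun z : Euc d₁ × Euc d₂ => u t z.1 z.2) ∞ volume
      ≤ ENNReal.ofReal (N.toReal + CH * T) := by
        rw [eLpNorm_exponent_top]
        exact eLpNormEssSup_le_of_ae_bound (Filter.Eventually.of_forall hle)
    _ = N + ENNReal.ofReal (CH * T) := by
        rw [ENNReal.ofReal_add ENNReal.toReal_nonneg (mul_nonneg hH.const_pos.le hT.le),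
          ENNReal.ofReal_toReal hNfin]
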